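/- Let $m\ge 2$. Consider $n$ parties, where party $i$ chooses a setting $s_i\in\{0,\dots,m-1\}$ and obtains an outcome $r_i\in\{0,\dots,k-1\}$. For a family of numbers $P(r_1,\dots,r_n\mid s_1,\dots,s_n)$ write $\Sigma_s=\sum_i s_i$, $\Sigma_r=\sum_i r_i$, let $[X]_d\in\{0,\dots,d-1\}$ be the residue of $X$ modulo $d$, and let $P([\Sigma_r]_k=r)$ be the probability, for the settings $\vec s$, that the sum of the outcomes is $r$ modulo $k$. Define $$\Omega(n,m,k)=\sum_{\vec s:\,[\Sigma_s]_m=0}\ \sum_{r=0}^{k-1}\Big[r-\Big\lfloor\frac{\Sigma_s}{m}\Big\rfloor\Big]_k P([\Sigma_r]_k=r)+\sum_{\vec s:\,[\Sigma_s]_m=1}\ \sum_{r=0}^{k-1}\Big[-r+\Big\lfloor\frac{\Sigma_s}{m}\Big\rfloor\Big]_k P([\Sigma_r]_k=r).$$ Call $P$ a quantum correlation if on some complex Hilbert space of arbitrary dimension there are POVMs $(M^{i}_{x,a})_{a}$ for every party $i$ and setting $x$, operators of different parties commuting, and a state $\varphi$ (a normalized positive linear functional on the bounded operators, for example $T\mapsto\operatorname{tr}(\rho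 T)$ for a density operator $\rho$), with $P(\vec r\mid\vec s)=\varphi\big(\prod_i M^{i}_{s_i,r_i}\big)$. This includes the tensor product models, where party $i$ acts on the $i$-th factor of $H_1\otimes\cdots\otimes H_n$. (i) For every $n\ge 2$, every $n$-party quantum correlation with $m$ settings and $k=2$ outcomes per party satisfies $$\Omega(n,m,2)\ \ge\ m^{\,n-1}\Big(1-\cos\frac{\pi}{2m}\Big).$$ (ii) For $n=2$ the bound is the Tsirelson bound: $m\left(1-\cos\frac{\pi}{2m}\right)$ is the least value of $\Omega(2,m,2)$ over all quantum correlations of the form $P(r_1,r_2\mid s_1,s_2)=\operatorname{tr}\big(\rho\,(M^1_{s_1,r_1}\otimes M^2_{s_2,r_2})\big)$ with a density matrix $\rho$ on a finite-dimensional space $\mathbb C^{d_1}\otimes\mathbb C^{d_2}$ and POVMs $M^1$, $M^2$ on the factors. -/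

import Mathlib

universe u

namespace Bell

/-- The data of an `n`-party experiment with `m` settings and `k` outcomes per party:
`P s r` is the probability of the outcomes `r = (r₁, …, rₙ)` when the parties choose the
settings `s = (s₁, …, sₙ)`. Settings and outcomes are numbered from `0`. -/
abbrev Correlation (n m k : ℕ) : Type := (Fin n → Fin m) → (Fin n → Fin k) → ℝ

section Expression

variable {n m k : ℕ}

/-- The sum of a list of settings, or of outcomes, as a natural number. -/
def total {d : ℕ} (v : Fin n → Fin d) : ℕ := ∑ i, (v i : ℕ)

/-- The probability, for the settings `s`, that the sum of all outcomes is `r` modulo `k`. -/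
noncomputable def probSum (P : Correlation n m k) (s : Fin n → Fin m) (r : Fin k) : ℝ :=
  ∑ o : Fin n → Fin k with total o % k = (r : ℕ), P s o

/-- The Bell expression `Ω(n, m, k)`, evaluated at the correlation `P`.
The settings enter through `total s % m` and `total s / m = ⌊total s / m⌋`; the coefficients
are residues modulo `k` in `{0, …, k - 1}`. -/
noncomputable def omega (P : Correlation n m k) : ℝ :=
  (∑ s : Fin n → Fin m with total s % m = 0, ∑ r : Fin k,
      ((((r : ℕ) : ℤ) - ((total s / m : ℕ) : ℤ)) % (k : ℤ) : ℤ) * probSum P s r) +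
  (∑ s : Fin n → Fin m with total s % m = 1, ∑ r : Fin k,
      ((-((r : ℕ) : ℤ) + ((total s / m : ℕ) : ℤ)) % (k : ℤ) : ℤ) * probSum P s r)

end Expression

/-- A state on the bounded operators of a Hilbert space: a positive linear functional with
value `1` at the identity. Every density operator `ρ` gives one, `T ↦ tr (ρ T)`. -/
def IsState {H : Type u} [NormedAddCommGroup H] [InnerProductSpace ℂ H] [CompleteSpace H]
    (φ : (H →L[ℂ] H) →ₗ[ℂ] ℂ) : Prop :=
  (∀ T : H →L[ℂ] H, T.IsPositive → 0 ≤ (φ T).re ∧ (φ T).im = 0) ∧ φ 1 = 1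

/-- Quantum correlations in the most general sense: on a complex Hilbert space of any dimension,
party `i` with setting `x` measures a POVM `(M i x a)ₐ`, operators of different parties commute,
and `P s r` is the expectation of `∏ i, M i (s i) (r i)` in some state. Tensor product
models are the case in which the operators of party `i` act on the `i`-th factor only. -/
def IsQuantum {n m k : ℕ} (P : Correlation n m k) : Prop :=
  ∃ (H : Type u) (_ : NormedAddCommGroup H) (_ : InnerProductSpace ℂ H) (_ : CompleteSpace H)
    (φ : (H →L[ℂ] H) →ₗ[ℂ] ℂ) (M : Fin n → Fin m → Fin k → H →L[ℂ] H),
    IsState φ ∧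
    (∀ i x a, (M i x a).IsPositive) ∧
    (∀ i x, ∑ a, M i x a = 1) ∧
    (∀ i j, i ≠ j → ∀ x y a b, Commute (M i x a) (M j y b)) ∧
    ∀ s r, (P s r : ℂ) = φ (List.ofFn fun i => M i (s i) (r i)).prod

section Tensor

open scoped ComplexOrder

variable {n : ℕ} {d : Fin n → ℕ}

/-- The tensor (Kronecker) product of square matrices `A i` of sizes `d i`. -/
def tensor (A : ∀ i, Matrix (Fin (d i)) (Fin (d i)) ℂ) :
    Matrix (∀ i, Fin (d i)) (∀ i, Fin (d i)) ℂ :=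
  Matrix.of fun a b => ∏ i, A i (a i) (b i)

/-- Correlations of finite-dimensional tensor product models: party `i` holds a system `ℂ ^ (d i)`
and measures POVMs on it, and the parties share a density matrix `ρ` on the tensor product;
the probabilities are given by the Born rule `tr (ρ (M₁ ⊗ ⋯ ⊗ Mₙ))`. -/
def IsTensorQuantum {n m k : ℕ} (P : Correlation n m k) : Prop :=
  ∃ (d : Fin n → ℕ) (ρ : Matrix (∀ i, Fin (d i)) (∀ i, Fin (d i)) ℂ)
    (M : ∀ i, Fin m → Fin k → Matrix (Fin (d i)) (Fin (d i)) ℂ),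
    ρ.PosSemidef ∧ ρ.trace = 1 ∧
    (∀ i x a, (M i x a).PosSemidef) ∧
    (∀ i x, ∑ a, M i x a = 1) ∧
    ∀ s r, (P s r : ℂ) = (ρ * tensor fun i => M i (s i) (r i)).trace

theorem tensor_mul (A B : ∀ i, Matrix (Fin (d i)) (Fin (d i)) ℂ) :
    tensor A * tensor B = tensor fun i => A i * B i := by
  ext a b
  simp only [tensor, Matrix.mul_apply, Matrix.of_apply]
  rw [Finset.prod_univ_sum, Fintype.piFinset_univ]
  exact Finset.sum_congr rfl fun c _ => Finset.prod_mul_distrib.symm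

theorem tensor_one : tensor (fun i => (1 : Matrix (Fin (d i)) (Fin (d i)) ℂ)) = 1 := by
  ext a b
  simp only [tensor, Matrix.of_apply, Matrix.one_apply, Finset.prod_ite_zero,
    Finset.prod_const_one, funext_iff, Finset.mem_univ, true_implies]

theorem tensor_conjTranspose (A : ∀ i, Matrix (Fin (d i)) (Fin (d i)) ℂ) :
    (tensor A).conjTranspose = tensor fun i => (A i).conjTranspose := by
  ext a b
  simp [tensor, Matrix.conjTranspose_apply]

/-- The operator `1 ⊗ ⋯ ⊗ A ⊗ ⋯ ⊗ 1` with `A` at the `i`-th place. -/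
def localOp (i : Fin n) (A : Matrix (Fin (d i)) (Fin (d i)) ℂ) :
    Matrix (∀ i, Fin (d i)) (∀ i, Fin (d i)) ℂ :=
  tensor (Function.update (fun j => (1 : Matrix (Fin (d j)) (Fin (d j)) ℂ)) i A)

theorem localOp_one (i : Fin n) :
    localOp i (1 : Matrix (Fin (d i)) (Fin (d i)) ℂ) = 1 := by
  rw [localOp, Function.update_eq_self_iff.2 rfl, tensor_one]

theorem localOp_sum {k : ℕ} (i : Fin n) (A : Fin k → Matrix (Fin (d i)) (Fin (d i)) ℂ) :
    ∑ a, localOp i (A a) = localOp i (∑ a, A a) := by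
  ext p q
  have h : ∀ B : Matrix (Fin (d i)) (Fin (d i)) ℂ, localOp i B p q =
      B (p i) (q i) * ∏ j ∈ Finset.univ.erase i,
        (1 : Matrix (Fin (d j)) (Fin (d j)) ℂ) (p j) (q j) := by
    intro B
    rw [localOp, tensor, Matrix.of_apply, ← Finset.mul_prod_erase _ _ (Finset.mem_univ i)]
    congr 1
    · simp
    · refine Finset.prod_congr rfl fun j hj => ?_
      rw [Function.update_of_ne (Finset.ne_of_mem_erase hj)]
  rw [Matrix.sum_apply, h, Matrix.sum_apply, Finset.sum_mul]
  exact Finset.sum_congr rfl fun a _ => h _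

theorem localOp_commute {i j : Fin n} (hij : i ≠ j) (A : Matrix (Fin (d i)) (Fin (d i)) ℂ)
    (B : Matrix (Fin (d j)) (Fin (d j)) ℂ) : Commute (localOp i A) (localOp j B) := by
  rw [Commute, SemiconjBy, localOp, localOp, tensor_mul, tensor_mul]
  congr 1
  funext l
  by_cases h : l = i
  · subst h
    simp [Function.update_of_ne hij]
  · simp [Function.update_of_ne h]

theorem localOp_posSemidef (i : Fin n) {A : Matrix (Fin (d i)) (Fin (d i)) ℂ}
    (hA : A.PosSemidef) : (localOp i A).PosSemidef := by
  obtain ⟨B, rfl⟩ : ∃ B, A = B.conjTranspose * B := by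
    open scoped MatrixOrder in
    exact CStarAlgebra.nonneg_iff_eq_star_mul_self.1 hA.nonneg
  have : localOp i (B.conjTranspose * B) = (localOp i B).conjTranspose * localOp i B := by
    rw [localOp, localOp, tensor_conjTranspose, tensor_mul]
    congr 1
    funext l
    by_cases h : l = i
    · subst h
      simp
    · simp [Function.update_of_ne h]
  rw [this]
  exact Matrix.posSemidef_conjTranspose_mul_self _

theorem localOp_prod (A : ∀ i, Matrix (Fin (d i)) (Fin (d i)) ℂ) (l : List (Fin n))
    (hl : l.Nodup) :
    (l.map fun i => localOp i (A i)).prod = tensor fun i => if i ∈ l then A i else 1 := by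
  induction l with
  | nil => simpa using tensor_one.symm
  | cons j l ih =>
    rw [List.nodup_cons] at hl
    rw [List.map_cons, List.prod_cons, ih hl.2, localOp, tensor_mul]
    congr 1
    funext i
    by_cases h : i = j
    · subst h
      simp [hl.1]
    · simp [h]

/-- Every correlation of a finite-dimensional tensor product model is quantum
in the general sense. -/
theorem IsTensorQuantum.isQuantum {n m k : ℕ} {P : Correlation n m k}
    (hP : IsTensorQuantum P) : IsQuantum.{0} P := by
  obtain ⟨d, ρ, M, hρ, hρ1, hM, hM1, hPM⟩ := hP
  let e := Matrix.toEuclideanCLM (n := ∀ i, Fin (d i)) (𝕜 := ℂ)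
  have hpos : ∀ A, (e A).IsPositive ↔ A.PosSemidef := fun A => by
    rw [← ContinuousLinearMap.isPositive_toLinearMap_iff,
      Matrix.coe_toEuclideanCLM_eq_toEuclideanLin, Matrix.isPositive_toEuclideanLin_iff]
  refine ⟨EuclideanSpace ℂ (∀ i, Fin (d i)), inferInstance, inferInstance, inferInstance,
    (Matrix.traceLinearMap _ ℂ ℂ) ∘ₗ (LinearMap.mulLeft ℂ ρ) ∘ₗ
      (e.symm.toAlgEquiv.toLinearMap), fun i x a => e (localOp i (M i x a)),
    ⟨fun T hT => ?_, ?_⟩, fun i x a => ?_, fun i x => ?_, fun i j hij x y a b => ?_,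
    fun s r => ?_⟩
  · obtain ⟨A, rfl⟩ := e.surjective T
    have hA := (hpos A).1 hT
    obtain ⟨C, rfl⟩ : ∃ C, ρ = C.conjTranspose * C := by
      open scoped MatrixOrder in
      exact CStarAlgebra.nonneg_iff_eq_star_mul_self.1 hρ.nonneg
    have h0 : 0 ≤ (C.conjTranspose * C * A).trace := by
      rw [Matrix.mul_assoc, Matrix.trace_mul_comm]
      exact (hA.mul_mul_conjTranspose_same C).trace_nonneg
    have h1 : 0 ≤ (C.conjTranspose * C * A).trace.re ∧
        0 = (C.conjTranspose * C * A).trace.im := by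
      simpa using Complex.le_def.1 h0
    have h4 : ((C.conjTranspose * C) * e.symm (e A)).trace =
        (C.conjTranspose * C * A).trace := by rw [e.symm_apply_apply]
    change 0 ≤ ((C.conjTranspose * C) * e.symm (e A)).trace.re ∧
      ((C.conjTranspose * C) * e.symm (e A)).trace.im = 0
    rw [h4]
    exact ⟨h1.1, h1.2.symm⟩
  · simpa using hρ1
  · exact (hpos _).2 (localOp_posSemidef i (hM i x a))
  · rw [← map_sum, localOp_sum, hM1, localOp_one, map_one]
  · exact (localOp_commute hij _ _).map e
  · have h2 : (List.ofFn fun i => e (localOp i (M i (s i) (r i)))).prod =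
        e (tensor fun i => M i (s i) (r i)) := by
      have h3 := localOp_prod (fun i => M i (s i) (r i)) _ (List.nodup_finRange n)
      simp only [List.mem_finRange, if_true] at h3
      rw [← h3, map_list_prod, List.map_map, List.ofFn_eq_map]
      rfl
    rw [h2, hPM]
    change _ = (ρ * e.symm (e _)).trace
    rw [e.symm_apply_apply]

end Tensor

end Bell

/-! With two outcomes every coefficient of `omega` is a parity indicator, so the settings `s`
contribute (1 - (-1)^q E(s)) / 2, where q = ⌊Σ_s / m⌋ and E is the full correlator. Fix the settings
of all parties but the first two. The 2m remaining pairs of settings are the edges of a cycle on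
which the first party's observables alternate with products of the observables of all other parties.
Once the signs (-1)^q are absorbed into the observables (`antiperiodic`), the cycle becomes a chain
of 2m steps from a vector to its negative.

All these operators are contractions, hence vectors of the unit ball for the semi-inner product Re
φ(X* Y). By `sum_bilinForm_chain_le` the correlations along the chain add up to at most 2m
cos(π/2m), the value for equal planar steps through a half turn. Each of the m^(n-2) choices of the
fixed settings thus contributes at least m(1 - cos(π/2m)).

For n = 2 real qubit measurements on a maximally entangled pair make every step of the chain equal
to cos(π/2m), so the bound is attained. -/

namespace Bell

/-! ### Chains of vectors in a semi-inner product space. -/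

section Chain

variable {E : Type*} [AddCommGroup E] [Module ℝ E]

/-- Expand β(z, z) ≥ 0 for z = q u - p v - s w. The bound is sharp for unit vectors with z = 0; for
planar w, u, v at angles 0, x, x + θ this happens with p = sin x, q = sin (x + θ), s = sin θ. -/
theorem bilinForm_apply_le_of_psd (β : LinearMap.BilinForm ℝ E) (hsymm : ∀ x y, β x y = β y x)
    (hpos : ∀ x, 0 ≤ β x x) {u v w : E} (hu : β u u ≤ 1) (hv : β v v ≤ 1) (hw : β w w ≤ 1)
    {p q : ℝ} (hp : 0 < p) (hq : 0 < q) (s : ℝ) :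
    β u v ≤ (p ^ 2 + q ^ 2 + s ^ 2) / (2 * p * q) - s / p * β u w + s / q * β v w := by
  have h := hpos (q • u - p • v - s • w)
  simp only [map_sub, LinearMap.sub_apply, map_smul, LinearMap.smul_apply, smul_eq_mul] at h
  rw [hsymm v u, hsymm w u, hsymm w v] at h
  have h1 : 0 ≤ p ^ 2 + q ^ 2 + s ^ 2 - 2 * p * q * β u v - 2 * q * s * β u w
      + 2 * p * s * β v w := by
    nlinarith [mul_le_mul_of_nonneg_left hu (sq_nonneg q),
      mul_le_mul_of_nonneg_left hv (sq_nonneg p), mul_le_mul_of_nonneg_left hw (sq_nonneg s)]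
  have h2 : (p ^ 2 + q ^ 2 + s ^ 2) / (2 * p * q) - s / p * β u w + s / q * β v w - β u v =
      (p ^ 2 + q ^ 2 + s ^ 2 - 2 * p * q * β u v - 2 * q * s * β u w
      + 2 * p * s * β v w) / (2 * p * q) := by
    field_simp
    ring
  have h3 := div_nonneg h1 (by positivity : 0 ≤ 2 * p * q)
  rw [← h2] at h3
  linarith

theorem sin_add_sq_div {x θ : ℝ} (hx : Real.sin x ≠ 0) (hy : Real.sin (x + θ) ≠ 0) :
    (Real.sin x ^ 2 + Real.sin (x + θ) ^ 2 + Real.sin θ ^ 2) /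
        (2 * Real.sin x * Real.sin (x + θ)) =
      Real.cos θ + Real.sin θ / Real.sin x * Real.cos x -
        Real.sin θ / Real.sin (x + θ) * Real.cos (x + θ) := by
  have h3 := Real.sin_add x θ
  have hc := Real.sin_sq_add_cos_sq x
  have hc' := Real.sin_sq_add_cos_sq θ
  field_simp
  rw [Real.cos_add, h3]
  linear_combination -(Real.sin θ ^ 2) * hc - Real.sin x ^ 2 * hc'

/-- The inequality behind the chained Bell inequalities: a chain of `N + 2` vectors of the
unit ball that ends at the negative of its starting point. -/
theorem sum_bilinForm_chain_le (β : LinearMap.BilinForm ℝ E) (hsymm : ∀ x y, β x y = β y x)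
    (hpos : ∀ x, 0 ≤ β x x) (N : ℕ) (c : ℕ → E) (hc : ∀ j, β (c j) (c j) ≤ 1)
    (hcN : c (N + 2) = -c 0) :
    ∑ j ∈ Finset.range (N + 2), β (c j) (c (j + 1)) ≤
      (N + 2 : ℕ) * Real.cos (Real.pi / (N + 2 : ℕ)) := by
  set θ : ℝ := Real.pi / (N + 2 : ℕ) with hθ
  have hN : (0 : ℝ) < (N + 2 : ℕ) := by positivity
  have hNθ : (N + 2 : ℕ) * θ = Real.pi := by rw [hθ]; field_simp
  have hθ0 : 0 < θ := by positivity
  have hs : ∀ j : ℕ, j ≤ N → 0 < Real.sin ((j + 1 : ℕ) * θ) := by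
    intro j hj
    apply Real.sin_pos_of_pos_of_lt_pi
    · positivity
    · rw [← hNθ]
      gcongr
      omega
  -- The weighted deviation of β (c j) (c 0) from its value jθ in the planar optimum, cos (jθ). The
  -- weights make each step telescope: β (c j) (c (j + 1)) ≤ cos θ + h (j + 1) - h j.
  let h : ℕ → ℝ := fun j =>
    Real.sin θ / Real.sin (j * θ) * (β (c j) (c 0) - Real.cos (j * θ))
  have tele : ∀ K ≤ N, ∑ j ∈ Finset.range K, β (c (j + 1)) (c (j + 2)) ≤
      K * Real.cos θ + h (K + 1) - h 1 := by
    intro K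
    induction K with
    | zero => simp
    | succ K ih =>
      intro hK
      have h1 := ih (by omega)
      have e : ((K + 1 + 1 : ℕ) : ℝ) * θ = (K + 1 : ℕ) * θ + θ := by push_cast; ring
      have hp := hs K (by omega)
      have hq := hs (K + 1) hK
      have h2 := bilinForm_apply_le_of_psd β hsymm hpos (hc (K + 1)) (hc (K + 2)) (hc 0)
        hp hq (Real.sin θ)
      rw [e] at hq h2
      rw [sin_add_sq_div hp.ne' hq.ne', ← e] at h2
      rw [Finset.sum_range_succ]
      simp only [h] at h1 ⊢
      push_cast at h1 h2 ⊢
      linarith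
  have h1 := tele N le_rfl
  -- The first and last steps involve `c 0` itself. They cancel the inner products in the boundary
  -- terms `h 1` and `h (N + 1)`, leaving two more copies of cos θ.
  rw [Finset.sum_range_succ, Finset.sum_range_succ', hcN, map_neg, hsymm (c 0)]
  have hs1 : Real.sin θ ≠ 0 := by simpa using (hs 0 (by omega)).ne'
  have e : ((N + 1 : ℕ) : ℝ) * θ = Real.pi - θ := by rw [← hNθ]; push_cast; ring
  have hl : h (N + 1) = β (c (N + 1)) (c 0) + Real.cos θ := by
    simp only [h]
    rw [e, Real.sin_pi_sub, Real.cos_pi_sub, div_self hs1]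
    ring
  have hf : h 1 = β (c 1) (c 0) - Real.cos θ := by
    simp only [h, Nat.cast_one, one_mul]
    rw [div_self hs1, one_mul]
  rw [hl, hf] at h1
  push_cast
  linarith

end Chain

/-! ### The semi-inner product of a state, and contractions. -/

section State

variable {H : Type*} [NormedAddCommGroup H] [InnerProductSpace ℂ H] [CompleteSpace H]

/-- The real bilinear form `(X, Y) ↦ Re φ (X* Y)` of a linear functional on operators. -/
noncomputable def stateForm (φ : (H →L[ℂ] H) →ₗ[ℂ] ℂ) : LinearMap.BilinForm ℝ (H →L[ℂ] H) :=
  LinearMap.mk₂ ℝ (fun X Y => (φ (star X * Y)).re)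
    (fun X X' Y => by simp [add_mul])
    (fun r X Y => by
      rw [star_smul, star_trivial, smul_mul_assoc, ← Complex.coe_smul, map_smul]
      simp)
    (fun X Y Y' => by simp [mul_add])
    (fun r X Y => by
      rw [mul_smul_comm, ← Complex.coe_smul, map_smul]
      simp)

theorem stateForm_apply (φ : (H →L[ℂ] H) →ₗ[ℂ] ℂ) (X Y : H →L[ℂ] H) :
    stateForm φ X Y = (φ (star X * Y)).re := rfl

theorem isPositive_star_mul_self (X : H →L[ℂ] H) : (star X * X).IsPositive :=
  (ContinuousLinearMap.nonneg_iff_isPositive _).1 (star_mul_self_nonneg X)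

theorem stateForm_self_nonneg {φ : (H →L[ℂ] H) →ₗ[ℂ] ℂ} (hφ : IsState φ) (X : H →L[ℂ] H) :
    0 ≤ stateForm φ X X :=
  (hφ.1 _ (isPositive_star_mul_self X)).1

/-- Polarization: φ is real on (X + iY)*(X + iY), X*X and Y*Y, and the imaginary part of what
remains is Re φ(X*Y - Y*X). -/
theorem stateForm_symm {φ : (H →L[ℂ] H) →ₗ[ℂ] ℂ} (hφ : IsState φ) (X Y : H →L[ℂ] H) :
    stateForm φ X Y = stateForm φ Y X := by
  have h := (hφ.1 _ (isPositive_star_mul_self (X + Complex.I • Y))).2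
  have hX := (hφ.1 _ (isPositive_star_mul_self X)).2
  have hY := (hφ.1 _ (isPositive_star_mul_self Y)).2
  have e : star (X + Complex.I • Y) * (X + Complex.I • Y) =
      star X * X + star Y * Y + Complex.I • (star X * Y - star Y * X) := by
    have hI : Complex.I • Complex.I • (star Y * Y) = -(star Y * Y) := by
      rw [smul_smul, Complex.I_mul_I, neg_one_smul]
    simp only [star_add, star_smul, add_mul, mul_add, smul_mul_assoc, mul_smul_comm,
      smul_add, smul_neg, smul_sub, RCLike.star_def, Complex.conj_I, neg_smul, neg_mul, hI]
    abel
  rw [e] at h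
  simp only [map_add, map_smul, map_sub, Complex.add_im, hX, hY, smul_eq_mul, Complex.mul_im,
    Complex.I_re, Complex.I_im, Complex.sub_re] at h
  rw [stateForm_apply, stateForm_apply]
  linarith

theorem stateForm_self_le_one {φ : (H →L[ℂ] H) →ₗ[ℂ] ℂ} (hφ : IsState φ) {X : H →L[ℂ] H}
    (hX : ‖X‖ ≤ 1) : stateForm φ X X ≤ 1 := by
  have h : star X * X ≤ 1 := by
    have h1 := CStarAlgebra.star_mul_le_algebraMap_norm_sq (a := X)
    refine h1.trans ?_
    rw [← map_one (algebraMap ℝ (H →L[ℂ] H))]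
    exact algebraMap_mono _ (pow_le_one₀ (norm_nonneg _) hX)
  have h2 := (hφ.1 _ ((ContinuousLinearMap.nonneg_iff_isPositive _).1 (sub_nonneg.2 h))).1
  rw [map_sub, hφ.2, Complex.sub_re, Complex.one_re] at h2
  rw [stateForm_apply]
  linarith

/-- S and T = 1 - S commute, so Re ⟨Sv, Tv⟩ ≥ 0 and ‖Sv - Tv‖ ≤ ‖Sv + Tv‖ = ‖v‖. This handles POVMs
directly, with no dilation to projections. -/
theorem norm_sub_le_one_of_isPositive {S T : H →L[ℂ] H} (hS : S.IsPositive) (hT : T.IsPositive)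
    (hST : S + T = 1) : ‖S - T‖ ≤ 1 := by
  have hv : ∀ v, S v + T v = v := fun v => by rw [← add_apply, hST]; rfl
  have hcomm : ∀ v, T (S v) = S (T v) := fun v => by
    have h1 := hv (S v)
    have h2 := congrArg S (hv v)
    rw [map_add] at h2
    exact add_left_cancel (h1.trans h2.symm)
  refine ContinuousLinearMap.opNorm_le_bound _ zero_le_one fun v => ?_
  have h0 : 0 ≤ RCLike.re (inner ℂ (S v) (T v)) := by
    have h1 : inner ℂ (S v) (T v) = inner ℂ (S v) (T (S v)) + inner ℂ (S (T v)) (T v) := by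
      conv_lhs => rw [← hv v, map_add, inner_add_left, hv v]
      congr 1
      rw [hcomm]
      exact hS.isSelfAdjoint.isSymmetric (S v) (T v)
    rw [h1, map_add]
    exact add_nonneg (hT.re_inner_nonneg_right _) (hS.re_inner_nonneg_left _)
  have h1 := norm_sub_sq (𝕜 := ℂ) (S v) (T v)
  have h2 := norm_add_sq (𝕜 := ℂ) (S v) (T v)
  rw [hv] at h2
  rw [one_mul, sub_apply]
  refine le_of_sq_le_sq ?_ (norm_nonneg _)
  linarith

theorem norm_prod_ofFn_le_one {n : ℕ} (A : Fin n → H →L[ℂ] H) (hA : ∀ i, ‖A i‖ ≤ 1) :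
    ‖(List.ofFn A).prod‖ ≤ 1 := by
  induction n with
  | zero => exact ContinuousLinearMap.norm_id_le
  | succ n ih =>
    rw [List.ofFn_succ, List.prod_cons]
    exact (norm_mul_le _ _).trans
      (mul_le_one₀ (hA 0) (norm_nonneg _) (ih _ fun i => hA i.succ))

end State

/-! ### Reduction of `omega` to full correlators. -/

section Parity

variable {n m : ℕ}

/-- The full correlator: the expectation of the product of the outcomes, read as signs. -/
noncomputable def correlator (P : Correlation n m 2) (s : Fin n → Fin m) : ℝ :=
  ∑ o : Fin n → Fin 2, (-1) ^ total o * P s o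

theorem probSum_zero_add_probSum_one (P : Correlation n m 2) (s : Fin n → Fin m) :
    probSum P s 0 + probSum P s 1 = ∑ o, P s o := by
  rw [probSum, probSum, Finset.sum_filter, Finset.sum_filter, ← Finset.sum_add_distrib]
  refine Finset.sum_congr rfl fun o _ => ?_
  rcases Nat.mod_two_eq_zero_or_one (total o) with h | h <;> simp [h]

theorem probSum_zero_sub_probSum_one (P : Correlation n m 2) (s : Fin n → Fin m) :
    probSum P s 0 - probSum P s 1 = correlator P s := by
  rw [probSum, probSum, Finset.sum_filter, Finset.sum_filter, ← Finset.sum_sub_distrib]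
  refine Finset.sum_congr rfl fun o _ => ?_
  rcases Nat.mod_two_eq_zero_or_one (total o) with h | h
  · simp [h, (Nat.even_iff.2 h).neg_one_pow]
  · simp [h, (Nat.odd_iff.2 h).neg_one_pow]

/-- Modulo 2 the sign of r - q is irrelevant, so both kinds of coefficient give the probability that
the outcome sum differs in parity from q. -/
theorem sum_coeff_mul_probSum {P : Correlation n m 2} {s : Fin n → Fin m}
    (hP : ∑ o, P s o = 1) (q : ℕ) :
    (∑ r : Fin 2, ((((r : ℕ) : ℤ) - (q : ℤ)) % ((2 : ℕ) : ℤ) : ℤ) * probSum P s r =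
      (1 - (-1) ^ q * correlator P s) / 2) ∧
    (∑ r : Fin 2, ((-((r : ℕ) : ℤ) + (q : ℤ)) % ((2 : ℕ) : ℤ) : ℤ) * probSum P s r =
      (1 - (-1) ^ q * correlator P s) / 2) := by
  have h1 := probSum_zero_add_probSum_one P s
  have h2 := probSum_zero_sub_probSum_one P s
  rw [hP] at h1
  simp only [Fin.sum_univ_two, Fin.val_zero, Fin.val_one]
  rcases Nat.even_or_odd q with h | h
  · have e1 : (((0 : ℕ) : ℤ) - (q : ℤ)) % ((2 : ℕ) : ℤ) = 0 := by grind
    have e2 : (((1 : ℕ) : ℤ) - (q : ℤ)) % ((2 : ℕ) : ℤ) = 1 := by grind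
    have e3 : (-((0 : ℕ) : ℤ) + (q : ℤ)) % ((2 : ℕ) : ℤ) = 0 := by grind
    have e4 : (-((1 : ℕ) : ℤ) + (q : ℤ)) % ((2 : ℕ) : ℤ) = 1 := by grind
    rw [e1, e2, e3, e4, h.neg_one_pow]
    constructor <;> push_cast <;> linarith
  · have e1 : (((0 : ℕ) : ℤ) - (q : ℤ)) % ((2 : ℕ) : ℤ) = 1 := by grind
    have e2 : (((1 : ℕ) : ℤ) - (q : ℤ)) % ((2 : ℕ) : ℤ) = 0 := by grind
    have e3 : (-((0 : ℕ) : ℤ) + (q : ℤ)) % ((2 : ℕ) : ℤ) = 1 := by grind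
    have e4 : (-((1 : ℕ) : ℤ) + (q : ℤ)) % ((2 : ℕ) : ℤ) = 0 := by grind
    rw [e1, e2, e3, e4, h.neg_one_pow]
    constructor <;> push_cast <;> linarith

/-- The contribution of the settings `s` to `omega`. -/
noncomputable def omegaTerm (P : Correlation n m 2) (s : Fin n → Fin m) : ℝ :=
  (1 - (-1) ^ (total s / m) * correlator P s) / 2

theorem omega_eq_sum_omegaTerm {P : Correlation n m 2} (hP : ∀ s, ∑ o, P s o = 1) :
    omega P = (∑ s : Fin n → Fin m with total s % m = 0, omegaTerm P s) +
      ∑ s : Fin n → Fin m with total s % m = 1, omegaTerm P s := by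
  rw [omega]
  congr 1 <;> refine Finset.sum_congr rfl fun s _ => ?_
  · exact (sum_coeff_mul_probSum (hP s) _).1
  · exact (sum_coeff_mul_probSum (hP s) _).2

end Parity

/-! ### Parametrization of settings with prescribed residue. -/

section Reindex

variable {m : ℕ}

theorem mod_eq_iff_dvd_sub {a c : ℕ} (hc : c < m) : a % m = c ↔ (m : ℤ) ∣ (a : ℤ) - c := by
  rw [← Int.modEq_iff_dvd, Int.natCast_modEq_iff, Nat.ModEq, Nat.mod_eq_of_lt hc, eq_comm]

theorem total_cons {k : ℕ} (x : Fin m) (s : Fin k → Fin m) :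
    total (Fin.cons x s : Fin (k + 1) → Fin m) = x + total s := by
  simp [total, Fin.sum_univ_succ]

/-- The residue of an integer modulo `m`. -/
def residue (m : ℕ) [NeZero m] (z : ℤ) : Fin m :=
  ⟨(z % m).toNat, by
    have := Int.emod_lt_of_pos z (Int.natCast_pos.2 (NeZero.pos m))
    have := Int.emod_nonneg z (Int.natCast_ne_zero.2 (NeZero.ne m))
    omega⟩

variable [NeZero m]

theorem coe_residue (z : ℤ) : ((residue m z : ℕ) : ℤ) = z % m :=
  Int.toNat_of_nonneg (Int.emod_nonneg z (Int.natCast_ne_zero.2 (NeZero.ne m)))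

theorem residue_eq_iff (z : ℤ) (x : Fin m) : residue m z = x ↔ (m : ℤ) ∣ z - (x : ℕ) := by
  rw [Fin.ext_iff, ← Int.natCast_inj, coe_residue, ← Int.modEq_iff_dvd, Int.ModEq, eq_comm,
    Int.emod_eq_of_lt (Int.natCast_nonneg _) (Int.ofNat_lt.2 x.2)]

theorem dvd_sub_residue (z : ℤ) : (m : ℤ) ∣ z - (residue m z : ℕ) :=
  (residue_eq_iff z _).1 rfl

theorem sum_residue_neg (G : Fin m → ℝ) (e : ℤ) :
    ∑ x, G x = ∑ i ∈ Finset.range m, G (residue m (-(i + e))) := by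
  rw [Finset.sum_range]
  refine (Function.Bijective.sum_comp (e := fun i : Fin m => residue m (-((i : ℕ) + e)))
    (Finite.injective_iff_bijective.1 fun i j h => ?_) G).symm
  have h1 := dvd_sub (dvd_sub_residue (m := m) (-((j : ℕ) + e)))
    ((residue_eq_iff (-((i : ℕ) + e)) _).1 h)
  rw [show -(((j : ℕ) : ℤ) + e) - (residue m (-((j : ℕ) + e)) : ℕ) -
    (-(((i : ℕ) : ℤ) + e) - (residue m (-((j : ℕ) + e)) : ℕ)) = (i : ℕ) - (j : ℕ) by ring] at h1
  have h2 := (residue_eq_iff ((i : ℕ) : ℤ) j).2 h1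
  rwa [(residue_eq_iff ((i : ℕ) : ℤ) i).2 (by simp)] at h2

/-- The first setting runs over all residues and the congruence then determines the second. The free
shift `e` serves to align the sums for different `c`. -/
theorem sum_filter_total_mod {k : ℕ} (F : (Fin (k + 2) → Fin m) → ℝ) (c : ℕ) (hc : c < m)
    (e : ℤ) :
    ∑ s : Fin (k + 2) → Fin m with total s % m = c, F s =
      ∑ s : Fin k → Fin m, ∑ i ∈ Finset.range m,
        F (Fin.cons (residue m (-(i + e)))
          (Fin.cons (residue m (i + e + c - total s)) s)) := by
  have step : ∀ (j : ℕ) (G : (Fin (j + 1) → Fin m) → ℝ),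
      ∑ s, G s = ∑ s, ∑ x, G (Fin.cons x s) := by
    intro j G
    rw [← (Fin.consEquiv fun _ : Fin (j + 1) => Fin m).sum_comp, Fintype.sum_prod_type_right]
    rfl
  rw [Finset.sum_filter, step, step]
  refine Finset.sum_congr rfl fun s _ => ?_
  rw [Finset.sum_comm, sum_residue_neg _ e]
  refine Finset.sum_congr rfl fun i _ => ?_
  rw [Finset.sum_eq_single (residue m (i + e + c - total s)), if_pos]
  · rw [total_cons, total_cons, mod_eq_iff_dvd_sub hc]
    have h1 := dvd_sub_residue (m := m) (-(i + e))
    have h2 := dvd_sub_residue (m := m) (i + e + c - total s)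
    rw [← dvd_neg]
    convert dvd_add h1 h2 using 1
    push_cast
    ring
  · intro y _ hy
    rw [if_neg]
    intro h
    refine hy (Eq.symm ((residue_eq_iff _ _).2 ?_))
    rw [total_cons, total_cons, mod_eq_iff_dvd_sub hc] at h
    have h1 := dvd_sub_residue (m := m) (-(i + e))
    rw [← dvd_neg]
    convert dvd_add h h1 using 1
    push_cast
    ring
  · simp

end Reindex

/-! ### Absorbing the signs into an antiperiodic chain. -/

section Antiperiodic

variable {E : Type*} [AddCommGroup E] [Module ℝ E] {m : ℕ} [NeZero m]

/-- The extension of a family indexed by the residues modulo `m` to a family indexed by the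
integers that changes sign under translation by `m`. -/
noncomputable def antiperiodic (f : Fin m → E) (z : ℤ) : E :=
  (-1 : ℝ) ^ (z / (m : ℤ)) • f (residue m z)

theorem antiperiodic_sub_self (f : Fin m → E) (z : ℤ) :
    antiperiodic f (z - m) = -antiperiodic f z := by
  have hm : (m : ℤ) ≠ 0 := Int.natCast_ne_zero.2 (NeZero.ne m)
  have h : residue m (z - m) = residue m z := by
    rw [residue_eq_iff, show z - m - (residue m z : ℕ) = z - (residue m z : ℕ) - m by ring]
    exact dvd_sub (dvd_sub_residue z) dvd_rfl
  rw [antiperiodic, antiperiodic, h, Int.sub_ediv_of_dvd _ dvd_rfl, Int.ediv_self hm,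
    zpow_sub_one₀ (by norm_num), ← neg_smul]
  norm_num

theorem bilinForm_antiperiodic_self (β : LinearMap.BilinForm ℝ E) (f : Fin m → E) (z : ℤ) :
    β (antiperiodic f z) (antiperiodic f z) = β (f (residue m z)) (f (residue m z)) := by
  simp only [antiperiodic, map_smul, LinearMap.smul_apply, smul_eq_mul]
  rw [← mul_assoc, ← mul_zpow]
  simp

/-- Since 0 ≤ c < m, reducing z and w modulo m changes the quotient of the total from 0 to -(z / m +
w / m), whose parity is the sign carried by the two antiperiodic factors. -/
theorem bilinForm_antiperiodic (β : LinearMap.BilinForm ℝ E) (f g : Fin m → E) {z w : ℤ}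
    {t c : ℕ} (hc : c < m) (h : z + w + t = c) :
    β (antiperiodic f z) (antiperiodic g w) =
      (-1) ^ (((residue m z : ℕ) + ((residue m w : ℕ) + t)) / m) *
        β (f (residue m z)) (g (residue m w)) := by
  have hm : (m : ℤ) ≠ 0 := Int.natCast_ne_zero.2 (NeZero.ne m)
  have hq : ((((residue m z : ℕ) + ((residue m w : ℕ) + t)) / m : ℕ) : ℤ) =
      -(z / m + w / m) := by
    push_cast
    rw [coe_residue, coe_residue]
    have h1 := Int.emod_add_mul_ediv z m
    have h2 := Int.emod_add_mul_ediv w m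
    rw [show z % m + (w % m + t) = c + m * -(z / m + w / m) by linarith,
      Int.add_mul_ediv_left _ _ hm, Int.ediv_eq_zero_of_lt (by positivity) (by exact_mod_cast hc),
      zero_add]
  rw [← zpow_natCast (-1 : ℝ), hq, zpow_neg, ← inv_zpow, zpow_add₀ (by norm_num)]
  simp only [antiperiodic, map_smul, LinearMap.smul_apply, smul_eq_mul]
  norm_num
  ring

theorem sum_range_two_mul (f : ℕ → ℝ) (n : ℕ) :
    ∑ j ∈ Finset.range (2 * n), f j =
      ∑ i ∈ Finset.range n, (f (2 * i) + f (2 * i + 1)) := by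
  induction n with
  | zero => simp
  | succ n ih =>
    rw [Nat.mul_succ, Finset.sum_range_succ, Finset.sum_range_succ, ih, Finset.sum_range_succ,
      add_assoc]

theorem sum_antiperiodic_le (hm : 2 ≤ m) (β : LinearMap.BilinForm ℝ E)
    (hsymm : ∀ x y, β x y = β y x) (hpos : ∀ x, 0 ≤ β x x) {f g : Fin m → E}
    (hf : ∀ x, β (f x) (f x) ≤ 1) (hg : ∀ x, β (g x) (g x) ≤ 1) (t : ℤ) :
    ∑ i ∈ Finset.range m, (β (antiperiodic f (-i)) (antiperiodic g (i + 1 - t)) +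
      β (antiperiodic f (-(i + 1))) (antiperiodic g (i + 1 - t))) ≤
      2 * m * Real.cos (Real.pi / (2 * m)) := by
  -- Even places hold f at -i, odd places g at i + 1 - t; place 2m holds f at -m, the negative of
  -- the start.
  let c : ℕ → E := fun j => if j % 2 = 0 then antiperiodic f (-((j / 2 : ℕ) : ℤ))
    else antiperiodic g (((j / 2 : ℕ) : ℤ) + 1 - t)
  have c0 : ∀ i : ℕ, c (2 * i) = antiperiodic f (-(i : ℤ)) := fun i => by simp [c]
  have c1 : ∀ i : ℕ, c (2 * i + 1) = antiperiodic g ((i : ℤ) + 1 - t) := fun i => by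
    have h1 : (2 * i + 1) % 2 = 1 := by omega
    have h2 : (2 * i + 1) / 2 = i := by omega
    simp only [c, h1, h2, one_ne_zero, if_false]
  obtain ⟨N, hN⟩ : ∃ N, 2 * m = N + 2 := ⟨2 * m - 2, by omega⟩
  have h := sum_bilinForm_chain_le β hsymm hpos N c (fun j => ?_) ?_
  · rw [← hN, sum_range_two_mul] at h
    push_cast at h
    refine (Finset.sum_congr rfl fun i _ => ?_).trans_le h
    rw [c1, c0, show 2 * i + 1 + 1 = 2 * (i + 1) by ring, c0, hsymm (antiperiodic g _)]
    push_cast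
    rfl
  · simp only [c]
    split_ifs
    · rw [bilinForm_antiperiodic_self]; exact hf _
    · rw [bilinForm_antiperiodic_self]; exact hg _
  · rw [← hN, c0, show c 0 = _ from c0 0, ← antiperiodic_sub_self]
    simp

end Antiperiodic

/-! ### Sums and signs in ordered products. -/

section Products

theorem sum_prod_ofFn {R : Type*} [Semiring R] {n k : ℕ} (F : Fin n → Fin k → R) :
    ∑ o : Fin n → Fin k, (List.ofFn fun i => F i (o i)).prod =
      (List.ofFn fun i => ∑ a, F i a).prod := by
  induction n with
  | zero => simp
  | succ n ih =>
    rw [← (Fin.consEquiv fun _ : Fin (n + 1) => Fin k).sum_comp, Fintype.sum_prod_type,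
      List.ofFn_succ, List.prod_cons, ← ih, Finset.sum_mul_sum]
    refine Finset.sum_congr rfl fun a _ => Finset.sum_congr rfl fun o _ => ?_
    rw [List.ofFn_succ, List.prod_cons]
    rfl

theorem prod_ofFn_smul {R : Type*} [Ring R] [Algebra ℂ R] {n k : ℕ} (o : Fin n → Fin k)
    (T : Fin n → R) :
    (List.ofFn fun i => (-1 : ℂ) ^ (o i : ℕ) • T i).prod =
      (-1 : ℂ) ^ total o • (List.ofFn T).prod := by
  induction n with
  | zero => simp [total]
  | succ n ih =>
    rw [List.ofFn_succ, List.prod_cons, ih fun i => o i.succ, List.ofFn_succ, List.prod_cons,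
      smul_mul_smul_comm, ← pow_add]
    simp [total, Fin.sum_univ_succ]

end Products

/-! ### The lower bound for quantum correlations. -/

section Quantum

variable {H : Type u} [NormedAddCommGroup H] [InnerProductSpace ℂ H]

theorem sum_eq_one_of_born {n m k : ℕ} {P : Correlation n m k}
    {φ : (H →L[ℂ] H) →ₗ[ℂ] ℂ} {M : Fin n → Fin m → Fin k → H →L[ℂ] H} (hφ : φ 1 = 1)
    (hM : ∀ i x, ∑ a, M i x a = 1)
    (hP : ∀ s r, (P s r : ℂ) = φ (List.ofFn fun i => M i (s i) (r i)).prod)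
    (s : Fin n → Fin m) : ∑ o, P s o = 1 := by
  have h : ((∑ o, P s o : ℝ) : ℂ) = 1 := by
    push_cast
    simp only [hP]
    rw [← map_sum, sum_prod_ofFn fun i a => M i (s i) a]
    simp [hM, hφ]
  exact_mod_cast h

theorem correlator_eq_of_born {n m : ℕ} {P : Correlation n m 2}
    {φ : (H →L[ℂ] H) →ₗ[ℂ] ℂ} {M : Fin n → Fin m → Fin 2 → H →L[ℂ] H}
    (hP : ∀ s r, (P s r : ℂ) = φ (List.ofFn fun i => M i (s i) (r i)).prod)
    (s : Fin n → Fin m) :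
    correlator P s = (φ (List.ofFn fun i => M i (s i) 0 - M i (s i) 1).prod).re := by
  have h : ((correlator P s : ℝ) : ℂ) =
      φ (List.ofFn fun i => M i (s i) 0 - M i (s i) 1).prod := by
    rw [correlator]
    push_cast
    simp only [hP]
    have h2 : ∀ i, M i (s i) 0 - M i (s i) 1 =
        ∑ a : Fin 2, (-1 : ℂ) ^ (a : ℕ) • M i (s i) a := fun i => by
      simp [Fin.sum_univ_two, sub_eq_add_neg]
    simp only [h2]
    rw [← sum_prod_ofFn fun i (a : Fin 2) => (-1 : ℂ) ^ (a : ℕ) • M i (s i) a, map_sum]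
    refine Finset.sum_congr rfl fun o _ => ?_
    rw [prod_ofFn_smul o fun i => M i (s i) (o i), map_smul, smul_eq_mul]
  rw [← h, Complex.ofReal_re]

theorem le_omega_of_isQuantum {m k : ℕ} (hm : 2 ≤ m) {P : Correlation (k + 2) m 2}
    (hP : IsQuantum.{u} P) :
    (m : ℝ) ^ (k + 1) * (1 - Real.cos (Real.pi / (2 * m))) ≤ omega P := by
  obtain ⟨H, _, _, _, φ, M, hφ, hpos, hsum, -, hborn⟩ := hP
  have : NeZero m := ⟨by omega⟩
  -- The shifts 1 and 0 give both sums the same second setting i + 1 - Σ_s, so each i yields the two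
  -- chain edges at a common vertex.
  rw [omega_eq_sum_omegaTerm (sum_eq_one_of_born hφ.2 hsum hborn),
    sum_filter_total_mod _ 0 (by omega) 1, sum_filter_total_mod _ 1 (by omega) 0,
    ← Finset.sum_add_distrib]
  have hA : ∀ i x, ‖M i x 0 - M i x 1‖ ≤ 1 := fun i x =>
    norm_sub_le_one_of_isPositive (hpos i x 0) (hpos i x 1)
      (by rw [← Fin.sum_univ_two]; exact hsum i x)
  have key : ∀ s : Fin k → Fin m, (m : ℝ) * (1 - Real.cos (Real.pi / (2 * m))) ≤
      (∑ i ∈ Finset.range m, omegaTerm P (Fin.cons (residue m (-(i + 1)))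
        (Fin.cons (residue m (i + 1 + (0 : ℕ) - total s)) s))) +
      ∑ i ∈ Finset.range m, omegaTerm P (Fin.cons (residue m (-(i + 0)))
        (Fin.cons (residue m (i + 0 + (1 : ℕ) - total s)) s)) := by
    intro s
    let A : Fin m → H →L[ℂ] H := fun x => M 0 x 0 - M 0 x 1
    -- All parties but the first act as one party, whose observable is a contraction as a product of
    -- contractions.
    let B : Fin m → H →L[ℂ] H := fun y => (List.ofFn fun i : Fin (k + 1) =>
      M i.succ ((Fin.cons y s : Fin (k + 1) → Fin m) i) 0 -
        M i.succ ((Fin.cons y s : Fin (k + 1) → Fin m) i) 1).prod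
    have hterm : ∀ (c : ℕ) (z w : ℤ), c < m → z + w + total s = c →
        omegaTerm P (Fin.cons (residue m z) (Fin.cons (residue m w) s)) =
          (1 - stateForm φ (antiperiodic A z) (antiperiodic B w)) / 2 := by
      intro c z w hc h
      rw [bilinForm_antiperiodic _ A B hc h, omegaTerm, total_cons, total_cons,
        correlator_eq_of_born hborn, stateForm_apply, List.ofFn_succ, List.prod_cons]
      have hsa : star (A (residue m z)) = A (residue m z) :=
        ((hpos 0 _ 0).isSelfAdjoint.sub (hpos 0 _ 1).isSelfAdjoint).star_eq
      rw [hsa]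
      rfl
    have hle := sum_antiperiodic_le hm (stateForm φ) (stateForm_symm hφ)
      (stateForm_self_nonneg hφ) (f := A) (g := B)
      (fun x => stateForm_self_le_one hφ (hA 0 x))
      (fun y => stateForm_self_le_one hφ (norm_prod_ofFn_le_one _ fun i => hA _ _)) (total s)
    rw [← Finset.sum_add_distrib]
    have he : ∀ i ∈ Finset.range m,
        omegaTerm P (Fin.cons (residue m (-(i + 1)))
          (Fin.cons (residue m (i + 1 + (0 : ℕ) - total s)) s)) +
        omegaTerm P (Fin.cons (residue m (-(i + 0)))
          (Fin.cons (residue m (i + 0 + (1 : ℕ) - total s)) s)) =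
        1 - (stateForm φ (antiperiodic A (-i)) (antiperiodic B (i + 1 - total s)) +
          stateForm φ (antiperiodic A (-(i + 1))) (antiperiodic B (i + 1 - total s))) / 2 := by
      intro i _
      rw [hterm 0 _ _ (by omega) (by push_cast; ring), hterm 1 _ _ (by omega) (by push_cast; ring)]
      simp only [Nat.cast_zero, Nat.cast_one, add_zero]
      ring
    rw [Finset.sum_congr rfl he, Finset.sum_sub_distrib, ← Finset.sum_div]
    simp only [Finset.sum_const, Finset.card_range, nsmul_eq_mul, mul_one]
    linarith
  calc (m : ℝ) ^ (k + 1) * (1 - Real.cos (Real.pi / (2 * m)))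
      = ∑ _s : Fin k → Fin m, (m : ℝ) * (1 - Real.cos (Real.pi / (2 * m))) := by
        simp [pow_succ, mul_assoc]
    _ ≤ _ := Finset.sum_le_sum fun s _ => key s

end Quantum

/-! ### Optimal qubit measurements for two parties. -/

section Attained

/-- The real unit vector of `ℂ²` at the angle `x`. -/
noncomputable def qubit (x : ℝ) : Fin 2 → ℂ := ![(Real.cos x : ℂ), (Real.sin x : ℂ)]

/-- The projection onto the line spanned by `qubit x`. -/
noncomputable def qubitProj (x : ℝ) : Matrix (Fin 2) (Fin 2) ℂ :=
  Matrix.vecMulVec (qubit x) (star (qubit x))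

theorem qubitProj_apply (x : ℝ) (i j : Fin 2) :
    qubitProj x i j = qubit x i * qubit x j := by
  rw [qubitProj, Matrix.vecMulVec_apply]
  congr 1
  fin_cases j <;> simp [qubit, -Complex.ofReal_cos, -Complex.ofReal_sin]

theorem qubitProj_add_qubitProj (x : ℝ) : qubitProj x + qubitProj (x + Real.pi / 2) = 1 := by
  have h : (Real.sin x : ℂ) ^ 2 + (Real.cos x : ℂ) ^ 2 = 1 := by
    exact_mod_cast Real.sin_sq_add_cos_sq x
  ext i j
  rw [Matrix.add_apply, qubitProj_apply, qubitProj_apply]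
  fin_cases i <;> fin_cases j <;>
    simp [qubit, Real.cos_add_pi_div_two, Real.sin_add_pi_div_two, -Complex.ofReal_cos,
      -Complex.ofReal_sin]
  · linear_combination h
  · ring
  · ring
  · linear_combination h

/-- The vector `|00⟩ + |11⟩`. -/
def bellVector (a : Fin 2 → Fin 2) : ℂ := if a 0 = a 1 then 1 else 0

/-- The correlation of two qubits in a maximally entangled state, where party `i` with the
setting `x` measures in the basis at the angles `g i x` and `g i x + π / 2`. -/
noncomputable def qubitCorrelation {m : ℕ} (g : Fin 2 → Fin m → ℝ) : Correlation 2 m 2 :=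
  fun s r => Real.cos (g 0 (s 0) + (r 0 : ℕ) * (Real.pi / 2) -
    (g 1 (s 1) + (r 1 : ℕ) * (Real.pi / 2))) ^ 2 / 2

open scoped ComplexOrder in
theorem isTensorQuantum_qubitCorrelation {m : ℕ} (g : Fin 2 → Fin m → ℝ) :
    IsTensorQuantum (qubitCorrelation g) := by
  have hsum : ∀ f : (Fin 2 → Fin 2) → ℂ, ∑ a, f a = ∑ x, ∑ y, f ![x, y] := fun f => by
    rw [← (finTwoArrowEquiv (Fin 2)).symm.sum_comp, Fintype.sum_prod_type]
    rfl
  refine ⟨fun _ => 2, (1 / 2 : ℝ) • Matrix.vecMulVec bellVector (star bellVector),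
    fun i x a => qubitProj (g i x + (a : ℕ) * (Real.pi / 2)), ?_, ?_, fun i x a => ?_,
    fun i x => ?_, fun s r => ?_⟩
  · exact (Matrix.posSemidef_vecMulVec_self_star _).smul (by norm_num)
  · rw [Matrix.trace]
    refine (hsum _).trans ?_
    simp [Matrix.vecMulVec_apply, bellVector]
  · exact Matrix.posSemidef_vecMulVec_self_star _
  · rw [Fin.sum_univ_two]
    simpa using qubitProj_add_qubitProj (g i x)
  · rw [Matrix.trace]
    simp only [Matrix.diag_apply, Matrix.mul_apply]
    refine Eq.trans ?_ (hsum _).symm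
    simp only [qubitCorrelation]
    generalize hx : g 0 (s 0) + (r 0 : ℕ) * (Real.pi / 2) = x
    generalize hy : g 1 (s 1) + (r 1 : ℕ) * (Real.pi / 2) = y
    -- All vectors are real, so the trace is half the square of Σ_a qubit x a · qubit y a = cos (x -
    -- y).
    trans ∑ a : Fin 2, ∑ b : Fin 2, ∑ a' : Fin 2, ∑ b' : Fin 2,
        (1 / 2 * (bellVector ![a, b] * bellVector ![a', b'])) *
          (qubit x a' * qubit x a * (qubit y b' * qubit y b))
    · simp [bellVector, qubit, Real.cos_sub]
      ring
    · refine Finset.sum_congr rfl fun a _ => Finset.sum_congr rfl fun b _ => ?_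
      refine Eq.trans ?_ (hsum _).symm
      refine Finset.sum_congr rfl fun a' _ => Finset.sum_congr rfl fun b' _ => ?_
      simp [Matrix.vecMulVec_apply, tensor, bellVector, qubitProj_apply, Fin.prod_univ_two, hx, hy]

theorem sum_outcomes_two (f : (Fin 2 → Fin 2) → ℝ) :
    ∑ o, f o = f ![0, 0] + f ![0, 1] + (f ![1, 0] + f ![1, 1]) := by
  rw [← (finTwoArrowEquiv (Fin 2)).symm.sum_comp, Fintype.sum_prod_type]
  simp only [Fin.sum_univ_two]
  rfl

theorem qubitCorrelation_aux (x : ℝ) : Real.cos (x + Real.pi / 2) ^ 2 = 1 - Real.cos x ^ 2 ∧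
    Real.cos (x - Real.pi / 2) ^ 2 = 1 - Real.cos x ^ 2 := by
  rw [Real.cos_add_pi_div_two, Real.cos_sub_pi_div_two, neg_sq, Real.sin_sq]
  exact ⟨rfl, rfl⟩

theorem sum_qubitCorrelation {m : ℕ} (g : Fin 2 → Fin m → ℝ) (s : Fin 2 → Fin m) :
    ∑ o, qubitCorrelation g s o = 1 := by
  rw [sum_outcomes_two]
  have h := qubitCorrelation_aux (g 0 (s 0) - g 1 (s 1))
  simp [qubitCorrelation]
  rw [← sub_sub, h.2, add_sub_right_comm, h.1]
  ring

theorem correlator_qubitCorrelation {m : ℕ} (g : Fin 2 → Fin m → ℝ) (s : Fin 2 → Fin m) :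
    correlator (qubitCorrelation g) s = Real.cos (2 * (g 0 (s 0) - g 1 (s 1))) := by
  rw [correlator, sum_outcomes_two, Real.cos_two_mul]
  have h := qubitCorrelation_aux (g 0 (s 0) - g 1 (s 1))
  simp [qubitCorrelation, total]
  rw [← sub_sub, h.2, add_sub_right_comm, h.1]
  ring

theorem cos_nat_mul_pi_add (q : ℕ) (x : ℝ) :
    (-1) ^ q * Real.cos (q * Real.pi + x) = Real.cos x := by
  rw [Real.cos_add, Real.sin_nat_mul_pi, Real.cos_nat_mul_pi, zero_mul, sub_zero, ← mul_assoc,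
    ← mul_pow]
  norm_num

/-- Angles at which all correlators in `omega` have the same size. -/
noncomputable def optimalAngle (m : ℕ) (i : Fin 2) (x : Fin m) : ℝ :=
  if i = 0 then (x : ℕ) * Real.pi / (2 * m) else (1 / 2 - (x : ℕ)) * Real.pi / (2 * m)

/-- Twice the angle difference is (Σ_s - 1/2)π/m = ⌊Σ_s/m⌋π ∓ π/(2m), with minus for residue 0 and
plus for residue 1; the multiple of π cancels the sign in `omegaTerm`. -/
theorem omegaTerm_optimalAngle {m : ℕ} (hm : 0 < m) (s : Fin 2 → Fin m)
    (hs : total s % m = 0 ∨ total s % m = 1) :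
    omegaTerm (qubitCorrelation (optimalAngle m)) s =
      (1 - Real.cos (Real.pi / (2 * m))) / 2 := by
  have hm0 : (m : ℝ) ≠ 0 := by positivity
  have ht : ((s 0 : ℕ) : ℝ) + (s 1 : ℕ) = m * (total s / m : ℕ) + (total s % m : ℕ) := by
    rw [← Nat.cast_mul, ← Nat.cast_add, ← Nat.cast_add, Nat.div_add_mod]
    simp [total]
  have hx : 2 * (optimalAngle m 0 (s 0) - optimalAngle m 1 (s 1)) =
      (total s / m : ℕ) * Real.pi + (2 * (total s % m : ℕ) - 1) * (Real.pi / (2 * m)) := by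
    simp only [optimalAngle, if_true, one_ne_zero, if_false]
    field_simp
    linear_combination 2 * ht
  rw [omegaTerm, correlator_qubitCorrelation, hx, cos_nat_mul_pi_add]
  rcases hs with h | h <;> rw [h]
  · simp
  · norm_num

theorem omega_optimalAngle {m : ℕ} (hm : 2 ≤ m) :
    omega (qubitCorrelation (optimalAngle m)) = m * (1 - Real.cos (Real.pi / (2 * m))) := by
  have : NeZero m := ⟨by omega⟩
  rw [omega_eq_sum_omegaTerm (sum_qubitCorrelation _),
    Finset.sum_congr rfl fun s hs =>
      omegaTerm_optimalAngle (by omega) s (Or.inl (Finset.mem_filter.1 hs).2),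
    Finset.sum_congr rfl fun s hs =>
      omegaTerm_optimalAngle (by omega) s (Or.inr (Finset.mem_filter.1 hs).2),
    sum_filter_total_mod (k := 0) _ 0 (by omega) 0, sum_filter_total_mod (k := 0) _ 1 (by omega) 0]
  simp
  ring

end Attained

end Bell

theorem mainTheorem6 (m : ℕ) (hm : 2 ≤ m) :
    (∀ n : ℕ, 2 ≤ n → ∀ P : Bell.Correlation n m 2, Bell.IsQuantum.{u} P →
      (m : ℝ) ^ (n - 1) * (1 - Real.cos (Real.pi / (2 * m))) ≤ Bell.omega P) ∧
    IsLeast {w : ℝ | ∃ P : Bell.Correlation 2 m 2, Bell.IsTensorQuantum P ∧ Bell.omega P = w}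
      (m * (1 - Real.cos (Real.pi / (2 * m)))) := by
  refine ⟨fun n hn P hP => ?_, ⟨_, Bell.isTensorQuantum_qubitCorrelation _,
    Bell.omega_optimalAngle hm⟩, ?_⟩
  · obtain ⟨k, rfl⟩ := Nat.exists_eq_add_of_le' hn
    exact Bell.le_omega_of_isQuantum hm hP
  · rintro _ ⟨P, hP, rfl⟩
    simpa using Bell.le_omega_of_isQuantum (k := 0) hm hP.isQuantum
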